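/- Let $\phi\colon (R,\mathfrak m,k)\to (S,\mathfrak n,l)$ be a local homomorphism of commutative noetherian local rings. Let $M$ be an $S$-module (not necessarily finitely generated), and let $N\neq 0$ be a finitely generated $S$-module; regard both as $R$-modules via $\phi$. Assume that $N$ has finite injective dimension over $R$, and that $\operatorname{depth}_R M=0$ or $M$ is finitely generated as an $R$-module. Then $$\operatorname{depth} R-\operatorname{depth}_R M=\sup\{\, i\ge 0 \mid \operatorname{Ext}^i_R(M,N)\neq 0\,\}.$$ Here the depth of an arbitrary $R$-module $X$ is $\operatorname{depth}_R X=\inf\{\, i\ge 0\mid \operatorname{Ext}^i_R(k,X)\neq 0\,\}$, with $\operatorname{depth} R=\operatorname{depth}_R R$, $\inf\emptyset=+\infty$ and $\sup\emptyset=-\infty$; in particular, for $M=0$ both sides are $-\infty$. -/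

import Mathlib

open CategoryTheory

universe u v w

/-- The depth of an arbitrary (not necessarily finitely generated) module `M` over a local ring
`(R, 𝔪, k)`: the infimum of the `i` with `Ext^i_R(k, M) ≠ 0`, equal to `⊤` if there is none
(for example for `M = 0`). The `Shrink` only moves `k = R/𝔪` into the universe of `M`. -/
noncomputable def localDepth (R : Type u) [CommRing R] [IsLocalRing R]
    (M : Type w) [AddCommGroup M] [Module R M] [Small.{w} R] : ℕ∞ :=
  ⨅ (i : ℕ) (_ : Nontrivial (Abelian.Ext
    (ModuleCat.of R (Shrink.{w} (R ⧸ IsLocalRing.maximalIdeal R))) (ModuleCat.of R M) i)), (i : ℕ∞)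

/-- The supremum of the `i` with `Ext^i_R(M, N) ≠ 0`, as an extended real number;
it is `⊥`, that is `-∞`, if there is no such `i`. -/
noncomputable def extSup (R : Type u) [CommRing R] [Small.{w} R]
    (M N : Type w) [AddCommGroup M] [Module R M] [AddCommGroup N] [Module R N] : EReal :=
  ⨆ (i : ℕ) (_ : Nontrivial (Abelian.Ext (ModuleCat.of R M) (ModuleCat.of R N) i)), (i : EReal)

/-! Let `t` be the largest `i` with Ext^i(k, N) ≠ 0. The engine is Nakayama over `S`: for finitely
generated `X` and `x ∈ 𝔪`, if `x` acts surjectively on Ext^i(X, N), then this Ext vanishes, because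
`N` is finite over `S` and `x` maps into `𝔫` (`subsingleton_ext_of_forall_exists_smul`).

With prime filtrations this gives Ext^i(L, N) = 0 for all `i > t` and all finitely generated `L`, so
`N` has injective dimension `t`. Hence Ext^t(-, N) turns injections into surjections. If `M` has
depth 0, then `k` embeds in `M` and the supremum is `t`. If `M ≠ 0` is finite over `R` of positive
depth, dividing by an `M`-regular `x ∈ 𝔪` lowers the depth by one and, by Nakayama, raises the
supremum by one. So depth plus supremum is always `t` (`exists_localDepth_add_eq`), and the case `M
= R` identifies `t` with depth `R`. -/

open Abelian IsLocalRing Pointwise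

/-! ### Nakayama's lemma for Ext -/

/-- The linear maps between finitely generated modules form a finite module over any algebra `S`
acting on the target, when `S` is noetherian. -/
theorem finite_linearMap_of_finite_target
    (R : Type u) [CommRing R] (S : Type v) [CommRing S] [IsNoetherianRing S] [Algebra R S]
    (M : Type*) [AddCommGroup M] [Module R M] [Module.Finite R M]
    (N : Type*) [AddCommGroup N] [Module R N] [Module S N] [IsScalarTower R S N]
    [Module.Finite S N] : Module.Finite S (M →ₗ[R] N) := by
  obtain ⟨n, f, hf⟩ := Module.Finite.exists_fin' R M
  have : Module.Finite S ((Fin n → R) →ₗ[R] N) :=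
    Module.Finite.equiv ((Pi.basisFun R (Fin n)).constr S (M' := N))
  refine Module.Finite.of_injective (LinearMap.lcomp S N f) fun g h hgh => ?_
  exact (LinearMap.cancel_right hf).1 hgh

/-- Nakayama over `S`: the maps `K → N` that factor through `f` form an `S`-submodule of the finite
`S`-module Hom_R(K, N), and `x` acts through an element of the maximal ideal of `S`. -/
theorem range_lcomp_eq_top_of_forall_exists
    {R : Type u} [CommRing R] [IsLocalRing R]
    (S : Type v) [CommRing S] [IsLocalRing S] [IsNoetherianRing S] [Algebra R S]
    [IsLocalHom (algebraMap R S)]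
    {K : Type*} [AddCommGroup K] [Module R K] [Module.Finite R K]
    {F : Type*} [AddCommGroup F] [Module R F]
    {N : Type*} [AddCommGroup N] [Module R N] [Module S N] [IsScalarTower R S N]
    [Module.Finite S N] (f : K →ₗ[R] F) {x : R} (hx : x ∈ maximalIdeal R)
    (h : ∀ g : K →ₗ[R] N, ∃ (g' : K →ₗ[R] N) (e : F →ₗ[R] N), g = e ∘ₗ f + x • g')
    (g : K →ₗ[R] N) : ∃ e : F →ₗ[R] N, g = e ∘ₗ f := by
  have := finite_linearMap_of_finite_target R S K N
  have hle : (⊤ : Submodule S (K →ₗ[R] N)) ≤ LinearMap.range (LinearMap.lcomp S N f) := by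
    refine Submodule.le_of_le_smul_of_le_jacobson_bot (I := Ideal.span {algebraMap R S x})
      Module.Finite.fg_top ?_ fun g _ => ?_
    · rw [IsLocalRing.jacobson_eq_maximalIdeal _ bot_ne_top, Ideal.span_singleton_le_iff_mem]
      exact map_nonunit (algebraMap R S) x hx
    · obtain ⟨g', e, rfl⟩ := h g
      refine Submodule.add_mem_sup ⟨e, rfl⟩ ?_
      rw [show x • g' = algebraMap R S x • g' by ext; simp]
      exact Submodule.smul_mem_smul (Ideal.mem_span_singleton_self _) trivial
  obtain ⟨e, he⟩ := hle (Submodule.mem_top (x := g))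
  exact ⟨e, he.symm⟩

/-- Projectivity of `T.X₂` makes Ext¹ the cokernel of Hom(X₂, N) → Hom(X₁, N). Nakayama is applied
to these Hom modules, so Ext itself needs no `S`-structure. -/
theorem subsingleton_ext_one_of_forall_exists_smul
    {R : Type u} [CommRing R] [IsLocalRing R] [Small.{w} R]
    (S : Type v) [CommRing S] [IsLocalRing S] [IsNoetherianRing S] [Algebra R S]
    [IsLocalHom (algebraMap R S)]
    (N : Type w) [AddCommGroup N] [Module R N] [Module S N] [IsScalarTower R S N]
    [Module.Finite S N] {T : ShortComplex (ModuleCat.{w} R)} (hT : T.ShortExact)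
    [Projective T.X₂] [Module.Finite R T.X₁] {x : R} (hx : x ∈ maximalIdeal R)
    (h : ∀ e : Ext T.X₃ (ModuleCat.of R N) 1, ∃ e', x • e' = e) :
    Subsingleton (Ext T.X₃ (ModuleCat.of R N) 1) := by
  have hsurj (e : Ext T.X₃ (ModuleCat.of R N) 1) : ∃ g : T.X₁ ⟶ ModuleCat.of R N,
      hT.extClass.comp (Ext.mk₀ g) (add_zero 1) = e := by
    obtain ⟨g, rfl⟩ := Ext.contravariant_sequence_exact₃ hT _ e (Ext.eq_zero_of_projective _)
      (add_zero 1)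
    obtain ⟨g, rfl⟩ := (Ext.mk₀_bijective _ _).2 g
    exact ⟨g, rfl⟩
  have hker (g : T.X₁ ⟶ ModuleCat.of R N)
      (hg : hT.extClass.comp (Ext.mk₀ g) (add_zero 1) = 0) :
      ∃ l : T.X₂ ⟶ ModuleCat.of R N, T.f ≫ l = g := by
    obtain ⟨l, hl⟩ := Ext.contravariant_sequence_exact₁ hT _ _ _ hg
    obtain ⟨l, rfl⟩ := (Ext.mk₀_bijective _ _).2 l
    rw [Ext.mk₀_comp_mk₀] at hl
    exact ⟨l, (Ext.mk₀_bijective _ _).1 hl⟩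
  refine subsingleton_of_forall_eq 0 fun e => ?_
  obtain ⟨g, rfl⟩ := hsurj e
  obtain ⟨e, he⟩ := range_lcomp_eq_top_of_forall_exists S T.f.hom hx
    (fun g => by
      obtain ⟨e, he⟩ := h (hT.extClass.comp (Ext.mk₀ (ModuleCat.ofHom g)) (add_zero 1))
      obtain ⟨g', rfl⟩ := hsurj e
      obtain ⟨l, hl⟩ := hker (ModuleCat.ofHom g + -(x • g')) (by
        rw [Ext.mk₀_add, Ext.comp_add, Ext.mk₀_neg, Ext.comp_neg, Ext.mk₀_smul, Ext.comp_smul,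
          ← he]
        exact add_neg_cancel _)
      refine ⟨g'.hom, l.hom, ?_⟩
      have := congr(ModuleCat.Hom.hom $hl)
      rw [ModuleCat.hom_comp, ModuleCat.hom_add, ModuleCat.hom_neg, ModuleCat.hom_smul] at this
      rw [this]
      simp) g.hom
  have : g = T.f ≫ ModuleCat.ofHom e := by
    ext1; exact he
  rw [this, ← Ext.mk₀_comp_mk₀]
  exact hT.extClass_comp_assoc (Ext.mk₀ (ModuleCat.ofHom e))

/-- Dimension shifting: the connecting map Ext^{i+1}(X₁, Y) → Ext^{i+2}(X₃, Y) is bijective and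
`R`-linear, so divisibility by `x` passes to the syzygy. -/
theorem forall_exists_smul_ext_of_shortExact
    {R : Type u} [CommRing R] [Small.{w} R] (Y : ModuleCat.{w} R)
    {T : ShortComplex (ModuleCat.{w} R)} (hT : T.ShortExact)
    [Projective T.X₂] {x : R} (i : ℕ) (h : ∀ e : Ext T.X₃ Y (i + 2), ∃ e', x • e' = e)
    (e : Ext T.X₁ Y (i + 1)) : ∃ e', x • e' = e := by
  obtain ⟨e', he⟩ := h (hT.extClass.comp e (add_comm 1 _))
  obtain ⟨g, rfl⟩ := precomp_extClass_surjective_of_projective_X₂ Y hT _ e'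
  obtain ⟨l, hl⟩ := Ext.contravariant_sequence_exact₁ hT Y (e + -(x • g)) (add_comm 1 _) (by
    rw [Ext.comp_add, Ext.comp_neg, Ext.comp_smul, ← he]
    exact add_neg_cancel _)
  refine ⟨g, ?_⟩
  rw [Ext.eq_zero_of_projective l, Ext.comp_zero] at hl
  exact (add_neg_eq_zero.1 hl.symm).symm

/-- Degree 0 is Nakayama for Hom, degree 1 is the cokernel description, and higher degrees reduce to
degree 1 by passing to syzygies, which stay finitely generated. -/
theorem subsingleton_ext_of_forall_exists_smul
    {R : Type u} [CommRing R] [IsLocalRing R] [IsNoetherianRing R] [Small.{w} R]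
    (S : Type v) [CommRing S] [IsLocalRing S] [IsNoetherianRing S] [Algebra R S]
    [IsLocalHom (algebraMap R S)]
    (N : Type w) [AddCommGroup N] [Module R N] [Module S N] [IsScalarTower R S N]
    [Module.Finite S N] (X : ModuleCat.{w} R) [Module.Finite R X] {x : R}
    (hx : x ∈ maximalIdeal R) (i : ℕ)
    (h : ∀ e : Ext X (ModuleCat.of R N) i, ∃ e', x • e' = e) :
    Subsingleton (Ext X (ModuleCat.of R N) i) := by
  induction i generalizing X with
  | zero =>
    let φ : Ext X (ModuleCat.of R N) 0 ≃ₗ[R] (X →ₗ[R] N) :=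
      Ext.linearEquiv₀.trans ModuleCat.homLinearEquiv
    refine φ.toEquiv.subsingleton_congr.2 (subsingleton_of_forall_eq 0 fun g => ?_)
    obtain ⟨e, rfl⟩ := range_lcomp_eq_top_of_forall_exists S (0 : X →ₗ[R] PUnit.{1}) hx
      (fun g => by
        obtain ⟨e, he⟩ := h (φ.symm g)
        exact ⟨φ e, 0, by rw [← map_smul, he]; simp⟩) g
    simp
  | succ i ih =>
    obtain ⟨F, _, _, _, _, f, hf⟩ := Module.exists_finite_presentation R X
    have hS := LinearMap.shortExact_shortComplexKer hf
    have hsurj := precomp_extClass_surjective_of_projective_X₂ (ModuleCat.of R N) hS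
    have : Module.Finite R f.shortComplexKer.X₁ := inferInstanceAs (Module.Finite R f.ker)
    cases i with
    | zero => exact subsingleton_ext_one_of_forall_exists_smul S N hS hx h
    | succ i =>
      have := ih _ (forall_exists_smul_ext_of_shortExact _ hS i h)
      exact (hsurj (i + 1)).subsingleton

/-- This is the long exact sequence of 0 → X → X → X/xX → 0; it supplies the hypothesis of Nakayama.
-/
theorem forall_exists_smul_of_subsingleton_ext_quotSMulTop
    {R : Type u} [CommRing R] [Small.{w} R] (Y X : ModuleCat.{w} R) {x : R}
    (hx : IsSMulRegular X x) {i : ℕ}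
    (h : Subsingleton (Ext (ModuleCat.of R (QuotSMulTop x X)) Y (i + 1))) (e : Ext X Y i) :
    ∃ e', x • e' = e := by
  obtain ⟨(l : Ext X Y i), (hl : (Ext.mk₀ (x • 𝟙 X)).comp l (zero_add i) = e)⟩ :=
    Ext.contravariant_sequence_exact₁ hx.smulShortComplex_shortExact Y
      (n₁ := i + 1) e (add_comm _ _) (h.elim _ _)
  refine ⟨l, ?_⟩
  rwa [Ext.mk₀_smul, Ext.smul_comp, Ext.mk₀_id_comp] at hl

/-! ### Dévissage to the residue field and Baer's criterion -/

theorem subsingleton_ext_of_shortExact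
    {R : Type u} [CommRing R] [Small.{w} R] {T : ShortComplex (ModuleCat.{w} R)}
    (hT : T.ShortExact) (Y : ModuleCat.{w} R) (i : ℕ)
    (h₁ : Subsingleton (Ext T.X₁ Y i)) (h₃ : Subsingleton (Ext T.X₃ Y i)) :
    Subsingleton (Ext T.X₂ Y i) := by
  refine subsingleton_of_forall_eq 0 fun e => ?_
  obtain ⟨l, rfl⟩ := Ext.contravariant_sequence_exact₂ hT Y e (h₁.elim _ _)
  rw [h₃.elim l 0, Ext.comp_zero]

theorem subsingleton_ext_iff_of_linearEquiv
    {R : Type u} [CommRing R] [Small.{w} R] {X X' : ModuleCat.{w} R} (e : X ≃ₗ[R] X')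
    (Y : ModuleCat.{w} R) (i : ℕ) :
    Subsingleton (Ext X Y i) ↔ Subsingleton (Ext X' Y i) := by
  have key : ∀ {X X' : ModuleCat.{w} R} (_ : X ≅ X'), Subsingleton (Ext X Y i) →
      Subsingleton (Ext X' Y i) := fun {X X'} e h => by
    refine subsingleton_of_forall_eq 0 fun y => ?_
    rw [← Ext.mk₀_id_comp y, ← e.inv_hom_id, ← Ext.mk₀_comp_mk₀_assoc,
      h.elim ((Ext.mk₀ e.hom).comp y (zero_add i)) 0, Ext.comp_zero]
  exact ⟨key e.toModuleIso, key e.symm.toModuleIso⟩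

/-- If `Ext^i(k, N)` vanishes for all `i ≥ n`, so does `Ext^i(L, N)` for every finitely
generated `L`. -/
theorem subsingleton_ext_of_subsingleton_ext_residueField
    {R : Type u} [CommRing R] [IsLocalRing R] [IsNoetherianRing R] [Small.{w} R]
    (S : Type v) [CommRing S] [IsLocalRing S] [IsNoetherianRing S] [Algebra R S]
    [IsLocalHom (algebraMap R S)]
    (N : Type w) [AddCommGroup N] [Module R N] [Module S N] [IsScalarTower R S N]
    [Module.Finite S N] {n : ℕ}
    (h : ∀ i, n ≤ i → Subsingleton (Ext (ModuleCat.of R (Shrink.{w} (R ⧸ maximalIdeal R)))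
      (ModuleCat.of R N) i))
    (L : Type w) [AddCommGroup L] [Module R L] [hL : Module.Finite R L] (i : ℕ) (hi : n ≤ i) :
    Subsingleton (Ext (ModuleCat.of R L) (ModuleCat.of R N) i) := by
  -- Noetherian induction on an ideal killing `L`, with a prime filtration of `L` inside each step.
  -- The filtration only preserves `I ≤ ann`; the ideal grows when some `R/𝔭` is divided by `x`.
  suffices H : ∀ (I : Ideal R) (L : Type w) [AddCommGroup L] [Module R L] [Module.Finite R L],
      I ≤ Module.annihilator R L → ∀ i, n ≤ i →
        Subsingleton (Ext (ModuleCat.of R L) (ModuleCat.of R N) i) from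
    H ⊥ L bot_le i hi
  intro I
  induction I using WellFoundedGT.induction with
  | _ I ih =>
  intro L _ _ hL
  induction hL using IsNoetherianRing.induction_on_isQuotientEquivQuotientPrime R with
  | subsingleton L =>
    intro _ i _
    refine subsingleton_of_forall_eq 0 fun e => ?_
    have : 𝟙 (ModuleCat.of R L) = 0 :=
      (ModuleCat.isZero_of_subsingleton (ModuleCat.of R L)).eq_of_src _ _
    rw [← Ext.mk₀_id_comp e, this, Ext.mk₀_zero, Ext.zero_comp]
  | quotient L p f =>
    intro hI i hi
    rw [f.annihilator_eq, Ideal.annihilator_quotient] at hI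
    by_cases hp : p.1 = maximalIdeal R
    · rw [hp] at f
      exact (subsingleton_ext_iff_of_linearEquiv (X := ModuleCat.of R L)
        (X' := ModuleCat.of R (Shrink.{w} (R ⧸ maximalIdeal R)))
        (f.trans (Shrink.linearEquiv R _).symm) _ i).2 (h i hi)
    -- For `𝔭 ≠ 𝔪`, any `x ∈ 𝔪 \ 𝔭` is regular on `R/𝔭`, and the quotient is killed by `I + (x)`,
    -- which is strictly larger than `I` since `I ≤ 𝔭`.
    · obtain ⟨x, hx, hxp⟩ := SetLike.exists_of_lt
        (lt_of_le_of_ne (le_maximalIdeal p.2.ne_top) hp)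
      have hreg : IsSMulRegular L x := by
        rw [f.isSMulRegular_congr]
        have := Ideal.Quotient.isDomain p.1
        intro a b hab
        simp only [Algebra.smul_def] at hab
        exact mul_left_cancel₀ (mt Ideal.Quotient.eq_zero_iff_mem.1 hxp) hab
      refine subsingleton_ext_of_forall_exists_smul S N (ModuleCat.of R L) hx i
        (forall_exists_smul_of_subsingleton_ext_quotSMulTop _ _ hreg ?_)
      refine ih (I ⊔ Ideal.span {x}) ?_ _ ?_ (i + 1) (by lia)
      · refine lt_of_le_of_ne le_sup_left fun h => hxp (hI ?_)
        rw [h]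
        exact Ideal.mem_sup_right (Ideal.mem_span_singleton_self x)
      · refine sup_le ?_ ?_
        · rw [← Ideal.annihilator_quotient (I := p.1), ← f.annihilator_eq] at hI
          exact hI.trans (LinearMap.annihilator_le_of_surjective _ (Submodule.mkQ_surjective _))
        · rw [Ideal.span_singleton_le_iff_mem]
          exact QuotSMulTop.mem_annihilator _ _
  | exact L₁ L₂ L₃ f g hf hg hfg h₁ h₃ =>
    intro hI i hi
    have hT : (ModuleCat.shortComplexOfCompEqZero f g
      hfg.linearMap_comp_eq_zero).ShortExact :=
      ModuleCat.shortComplex_shortExact _ hfg hf hg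
    exact subsingleton_ext_of_shortExact hT _ i
      (h₁ (hI.trans (LinearMap.annihilator_le_of_injective f hf)) i hi)
      (h₃ (hI.trans (LinearMap.annihilator_le_of_surjective g hg)) i hi)

/-- A version of Baer's criterion for injective dimension: it suffices to test finitely generated
modules. -/
theorem hasInjectiveDimensionLT_of_forall_finite
    {R : Type u} [CommRing R] [Small.{w} R] (n : ℕ) (Y : ModuleCat.{w} R)
    (h : ∀ (L : ModuleCat.{w} R) [Module.Finite R L], Subsingleton (Ext L Y (n + 1))) :
    HasInjectiveDimensionLT Y (n + 1) := by
  induction n generalizing Y with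
  | zero =>
    rw [zero_add, ← injective_iff_hasInjectiveDimensionLT_one,
      ← Module.injective_iff_injective_object R Y, ← Module.Baer.iff_injective]
    intro I g
    let e := Shrink.linearEquiv.{w} R R
    let f : Shrink.{w} I →ₗ[R] Shrink.{w} R :=
      e.symm.toLinearMap ∘ₗ I.subtype ∘ₗ (Shrink.linearEquiv.{w} R I).toLinearMap
    have hf : Function.Injective f := by
      simp only [f, LinearMap.coe_comp, LinearEquiv.coe_coe]
      exact e.symm.injective.comp (I.injective_subtype.comp (LinearEquiv.injective _))
    have hT : (ModuleCat.shortComplexOfCompEqZero f f.range.mkQ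
        f.exact_map_mkQ_range.linearMap_comp_eq_zero).ShortExact :=
      ModuleCat.shortComplex_shortExact _ f.exact_map_mkQ_range hf (Submodule.mkQ_surjective _)
    have : Module.Finite R (Shrink.{w} R) := Module.Finite.equiv e.symm
    -- Ext¹(R/I, Y) = 0 lets `g` extend from `I` to `R`.
    have := h (ModuleCat.of R (Shrink.{w} R ⧸ f.range))
    obtain ⟨l, hl⟩ := Ext.contravariant_sequence_exact₁ hT Y
      (Ext.mk₀ (ModuleCat.ofHom (g ∘ₗ (Shrink.linearEquiv.{w} R I).toLinearMap)))
      (n₁ := 0 + 1) rfl (this.elim _ _)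
    obtain ⟨l, rfl⟩ := (Ext.mk₀_bijective _ _).2 l
    rw [Ext.mk₀_comp_mk₀] at hl
    have hl := congr(ModuleCat.Hom.hom $((Ext.mk₀_bijective _ _).1 hl))
    refine ⟨l.hom ∘ₗ e.symm.toLinearMap, fun x hx => ?_⟩
    have := congr($hl ((Shrink.linearEquiv.{w} R I).symm ⟨x, hx⟩))
    simpa [f] using this
  | succ n ih =>
    -- Embedding `Y` in an injective shifts the degree: the cokernel satisfies the hypothesis for
    -- `n`.
    obtain ⟨J, _, f, _⟩ := EnoughInjectives.presentation Y
    have hT : (ShortComplex.mk f (Limits.cokernel.π f) (Limits.cokernel.condition f)).ShortExact :=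
      { exact := ShortComplex.exact_cokernel f }
    refine (hT.hasInjectiveDimensionLT_X₃_iff n inferInstance).1 (ih _ fun L _ => ?_)
    have := h L
    refine subsingleton_of_forall_eq 0 fun e => ?_
    obtain ⟨l, rfl⟩ := Ext.covariant_sequence_exact₃ L hT e rfl (this.elim _ _)
    rw [Ext.eq_zero_of_injective l, Ext.zero_comp]

/-! ### Depth and regular elements -/

section localDepth

variable {R : Type u} [CommRing R] [IsLocalRing R]

theorem le_localDepth_iff [Small.{w} R] {M : Type w} [AddCommGroup M] [Module R M] {n : ℕ} :
    (n : ℕ∞) ≤ localDepth R M ↔ ∀ i < n, Subsingleton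
      (Ext (ModuleCat.of R (Shrink.{w} (R ⧸ maximalIdeal R))) (ModuleCat.of R M) i) := by
  simp only [localDepth, le_iInf_iff, Nat.cast_le]
  refine forall_congr' fun i => ?_
  rw [← not_nontrivial_iff_subsingleton, ← not_le]
  tauto

theorem localDepth_eq_coe_iff [Small.{w} R] {M : Type w} [AddCommGroup M] [Module R M] {n : ℕ} :
    localDepth R M = n ↔
      (∀ i < n, Subsingleton
        (Ext (ModuleCat.of R (Shrink.{w} (R ⧸ maximalIdeal R))) (ModuleCat.of R M) i)) ∧
      Nontrivial
        (Ext (ModuleCat.of R (Shrink.{w} (R ⧸ maximalIdeal R))) (ModuleCat.of R M) n) := by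
  have h₁ := le_localDepth_iff (R := R) (M := M) (n := n)
  have h₂ := le_localDepth_iff (R := R) (M := M) (n := n + 1)
  rw [Nat.forall_lt_succ_right, ← h₁, Nat.cast_succ] at h₂
  rw [← h₁, ← not_subsingleton_iff_nontrivial]
  constructor
  · intro h
    refine ⟨h.ge, fun hs => ?_⟩
    have := h₂.2 ⟨h.ge, hs⟩
    rw [h] at this
    exact absurd this (by exact_mod_cast Nat.not_succ_le_self n)
  · rintro ⟨h, hs⟩
    refine le_antisymm (not_lt.1 fun hlt => hs (h₂.1 ?_).2) h
    exact Order.add_one_le_of_lt hlt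

theorem le_localDepth_iff_exists_isRegular [IsNoetherianRing R] [Small.{w} R]
    (M : Type w) [AddCommGroup M] [Module R M] [Module.Finite R M] [Nontrivial M] (n : ℕ) :
    (n : ℕ∞) ≤ localDepth R M ↔ ∃ rs : List R, rs.length = n ∧
      (∀ r ∈ rs, r ∈ maximalIdeal R) ∧ RingTheory.Sequence.IsRegular M rs := by
  rw [le_localDepth_iff]
  refine (ModuleCat.exists_isRegular_tfae (maximalIdeal R) n (ModuleCat.of R M) ?_).out 1 3
  exact (Submodule.top_ne_ideal_smul_of_le_jacobson_annihilator
    (IsLocalRing.maximalIdeal_le_jacobson _)).symm.lt_top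

/-- The two modules may live in different universes, where their Ext groups are not directly
comparable; regular sequences are insensitive to this. -/
theorem localDepth_eq_of_linearEquiv [IsNoetherianRing R] [Small.{w} R] [Small.{v} R]
    {M : Type w} [AddCommGroup M] [Module R M] [Module.Finite R M] [Nontrivial M]
    {M' : Type v} [AddCommGroup M'] [Module R M'] (e : M ≃ₗ[R] M') :
    localDepth R M = localDepth R M' := by
  have := Module.Finite.equiv e
  have := e.symm.toEquiv.nontrivial
  refine ENat.eq_of_forall_natCast_le_iff fun n => ?_
  simp_rw [le_localDepth_iff_exists_isRegular, e.isRegular_congr]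

theorem smul_ext_residueField_eq_zero [Small.{w} R] (Y : ModuleCat.{w} R) {x : R}
    (hx : x ∈ maximalIdeal R) (i : ℕ)
    (e : Ext (ModuleCat.of R (Shrink.{w} (R ⧸ maximalIdeal R))) Y i) : x • e = 0 := by
  have h : x • 𝟙 (ModuleCat.of R (Shrink.{w} (R ⧸ maximalIdeal R))) = 0 := by
    refine ModuleCat.hom_ext (LinearMap.ext fun a => ?_)
    refine (Shrink.linearEquiv R (R ⧸ maximalIdeal R)).injective ?_
    change Shrink.linearEquiv R (R ⧸ maximalIdeal R) (x • a) =
      Shrink.linearEquiv R (R ⧸ maximalIdeal R) 0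
    rw [map_smul, map_zero, Algebra.smul_def]
    change Ideal.Quotient.mk _ x * _ = 0
    rw [Ideal.Quotient.eq_zero_iff_mem.2 hx, zero_mul]
  calc x • e = (Ext.mk₀ (x • 𝟙 _)).comp e (zero_add i) := by
        rw [Ext.mk₀_smul, Ext.smul_comp, Ext.mk₀_id_comp]
    _ = 0 := by rw [h, Ext.mk₀_zero, Ext.zero_comp]

/-- Multiplication by `x` is zero on every Ext^i(k, M), so the long exact sequence embeds Ext^0(k,
M) in 0 and makes Ext^{i+1}(k, M) a quotient of Ext^i(k, M/xM). -/
theorem localDepth_eq_succ_of_isSMulRegular [Small.{w} R]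
    {M : Type w} [AddCommGroup M] [Module R M] {x : R} (hx : x ∈ maximalIdeal R)
    (hreg : IsSMulRegular M x) {n : ℕ} (h : localDepth R (QuotSMulTop x M) = n) :
    localDepth R M = (n + 1 : ℕ) := by
  rw [localDepth_eq_coe_iff] at h ⊢
  obtain ⟨h, hn⟩ := h
  have hT : (ModuleCat.smulShortComplex (ModuleCat.of R M) x).ShortExact :=
    IsSMulRegular.smulShortComplex_shortExact hreg
  have hzero (i : ℕ)
      (e : Ext (ModuleCat.of R (Shrink.{w} (R ⧸ maximalIdeal R))) (ModuleCat.of R M) i) :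
      e.comp (Ext.mk₀ (x • 𝟙 (ModuleCat.of R M))) (add_zero i) = 0 := by
    rw [← Ext.smul_eq_comp_mk₀, smul_ext_residueField_eq_zero _ hx]
  have hs : ∀ i < n + 1, Subsingleton
      (Ext (ModuleCat.of R (Shrink.{w} (R ⧸ maximalIdeal R))) (ModuleCat.of R M) i) := by
    intro i hi
    refine subsingleton_of_forall_eq 0 fun e => ?_
    cases i with
    | zero =>
      have := hT.mono_f
      exact Ext.postcomp_mk₀_injective_of_mono _
        (ModuleCat.smulShortComplex (ModuleCat.of R M) x).f ((hzero 0 e).trans (map_zero _).symm)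
    | succ i =>
      obtain ⟨l, rfl⟩ := Ext.covariant_sequence_exact₁ _ hT e (hzero _ e) rfl
      rw [show l = 0 from (h i (by lia)).elim l 0, Ext.zero_comp]
      rfl
  refine ⟨hs, not_subsingleton_iff_nontrivial.1 fun hsub => ?_⟩
  refine not_subsingleton_iff_nontrivial.2 hn (subsingleton_of_forall_eq 0 fun e => ?_)
  obtain ⟨l, rfl⟩ := Ext.covariant_sequence_exact₃ _ hT e rfl (hsub.elim _ _)
  rw [show l = 0 from (hs n (by lia)).elim l 0, Ext.zero_comp]
  rfl

end localDepth

/-! ### The top Ext and the depth formula -/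

/-- Ext^{t+1} of the cokernel vanishes, so Ext^t(M, Y) → Ext^t(X, Y) is surjective. -/
theorem nontrivial_ext_of_mono {R : Type u} [CommRing R] [Small.{w} R] {X M : ModuleCat.{w} R}
    (f : X ⟶ M) [Mono f] (Y : ModuleCat.{w} R) {t : ℕ} [HasInjectiveDimensionLT Y (t + 1)]
    [h : Nontrivial (Ext X Y t)] : Nontrivial (Ext M Y t) := by
  have hT : (ShortComplex.mk f (Limits.cokernel.π f) (Limits.cokernel.condition f)).ShortExact :=
    { exact := ShortComplex.exact_cokernel f }
  refine not_subsingleton_iff_nontrivial.1 fun hsub =>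
    not_subsingleton_iff_nontrivial.2 h (subsingleton_of_forall_eq 0 fun e => ?_)
  obtain ⟨l, rfl⟩ := Ext.contravariant_sequence_exact₁ hT Y e (add_comm _ _)
    ((HasInjectiveDimensionLT.subsingleton Y (t + 1) _ le_rfl _).elim _ _)
  rw [hsub.elim l 0, Ext.comp_zero]

/-- A nonzero map out of the simple module `k` is injective. -/
theorem exists_mono_of_localDepth_eq_zero {R : Type u} [CommRing R] [IsLocalRing R] [Small.{w} R]
    {M : Type w} [AddCommGroup M] [Module R M] (h : localDepth R M = 0) :
    ∃ f : ModuleCat.of R (Shrink.{w} (R ⧸ maximalIdeal R)) ⟶ ModuleCat.of R M, Mono f := by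
  have h0 := (localDepth_eq_coe_iff (n := 0).1 h).2
  obtain ⟨e, he⟩ := exists_ne (0 : Ext (ModuleCat.of R (Shrink.{w} (R ⧸ maximalIdeal R)))
    (ModuleCat.of R M) 0)
  obtain ⟨f, rfl⟩ := (Ext.mk₀_bijective _ _).2 e
  refine ⟨f, ?_⟩
  rw [ModuleCat.mono_iff_injective]
  have : IsSimpleModule R (R ⧸ maximalIdeal R) :=
    isSimpleModule_iff_isCoatom.2 (maximalIdeal.isMaximal R).out
  have : IsSimpleModule R (Shrink.{w} (R ⧸ maximalIdeal R)) :=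
    IsSimpleModule.congr (Shrink.linearEquiv R (R ⧸ maximalIdeal R))
  refine (LinearMap.injective_or_eq_zero f.hom).resolve_right fun hf => he ?_
  rw [show f = 0 from ModuleCat.hom_ext hf, Ext.mk₀_zero]

theorem extSup_eq_coe {R : Type u} [CommRing R] [Small.{w} R]
    {M N : Type w} [AddCommGroup M] [Module R M] [AddCommGroup N] [Module R N] {s : ℕ}
    (hs : Nontrivial (Ext (ModuleCat.of R M) (ModuleCat.of R N) s))
    (h : ∀ i, s < i → Subsingleton (Ext (ModuleCat.of R M) (ModuleCat.of R N) i)) :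
    extSup R M N = s := by
  refine le_antisymm (iSup₂_le fun i hi => ?_) (le_iSup₂_of_le s hs le_rfl)
  have : i ≤ s := not_lt.1 fun hlt => not_subsingleton_iff_nontrivial.2 hi (h i hlt)
  exact_mod_cast this

theorem exists_hasInjectiveDimensionLT_and_nontrivial_ext_residueField
    {R : Type u} [CommRing R] [IsLocalRing R] [IsNoetherianRing R] [Small.{w} R]
    (S : Type v) [CommRing S] [IsLocalRing S] [IsNoetherianRing S] [Algebra R S]
    [IsLocalHom (algebraMap R S)]
    (N : Type w) [AddCommGroup N] [Module R N] [Module S N] [IsScalarTower R S N]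
    [Nontrivial N] [Module.Finite S N] (hN : injectiveDimension (ModuleCat.of R N) ≠ ⊤) :
    ∃ t : ℕ, HasInjectiveDimensionLT (ModuleCat.of R N) (t + 1) ∧
      Nontrivial (Ext (ModuleCat.of R (Shrink.{w} (R ⧸ maximalIdeal R)))
        (ModuleCat.of R N) t) := by
  classical
  obtain ⟨d, hd⟩ := (injectiveDimension_ne_top_iff _).1 hN
  have hex : ∃ n, ∀ i, n ≤ i → Subsingleton (Ext
      (ModuleCat.of R (Shrink.{w} (R ⧸ maximalIdeal R))) (ModuleCat.of R N) i) :=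
    ⟨d + 1, fun i hi => HasInjectiveDimensionLT.subsingleton _ (d + 1) i hi _⟩
  -- If Ext^i(k, N) vanished for all `i ≥ 0`, dévissage would give Hom(R, N) ≅ N = 0.
  obtain ⟨t, ht⟩ : ∃ t, Nat.find hex = t + 1 := by
    refine Nat.exists_eq_succ_of_ne_zero fun h0 => ?_
    have h := Nat.find_spec hex
    rw [h0] at h
    have : Module.Finite R (Shrink.{w} R) := Module.Finite.equiv (Shrink.linearEquiv R R).symm
    have := subsingleton_ext_of_subsingleton_ext_residueField S N h (Shrink.{w} R) 0 le_rfl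
    have e : Ext (ModuleCat.of R (Shrink.{w} R)) (ModuleCat.of R N) 0 ≃ N :=
      Ext.addEquiv₀.toEquiv.trans (ModuleCat.homEquiv.trans
        (((Shrink.linearEquiv R R).symm.congrLeft N R).symm.trans
          (LinearMap.ringLmapEquivSelf R R N)).toEquiv)
    exact not_subsingleton N e.symm.subsingleton
  have hvan := Nat.find_spec hex
  refine ⟨t, ?_, ?_⟩
  · refine hasInjectiveDimensionLT_of_forall_finite t _ fun L _ => ?_
    exact subsingleton_ext_of_subsingleton_ext_residueField S N hvan L (t + 1) ht.le
  · refine not_subsingleton_iff_nontrivial.1 fun hsub => Nat.find_min hex (m := t) (by lia) ?_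
    intro i hi
    obtain rfl | hi := hi.eq_or_lt
    · exact hsub
    · exact hvan i (by lia)

/-- Induction on the annihilator, which grows strictly from `M` to `M/xM`, replaces induction on
depth; finiteness of the depth then comes out as part of the conclusion. -/
theorem exists_localDepth_add_eq
    {R : Type u} [CommRing R] [IsLocalRing R] [IsNoetherianRing R] [Small.{w} R]
    (S : Type v) [CommRing S] [IsLocalRing S] [IsNoetherianRing S] [Algebra R S]
    [IsLocalHom (algebraMap R S)]
    (N : Type w) [AddCommGroup N] [Module R N] [Module S N] [IsScalarTower R S N]
    [Module.Finite S N] {t : ℕ} [HasInjectiveDimensionLT (ModuleCat.of R N) (t + 1)]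
    [Nontrivial (Ext (ModuleCat.of R (Shrink.{w} (R ⧸ maximalIdeal R))) (ModuleCat.of R N) t)]
    (M : Type w) [AddCommGroup M] [Module R M] [Module.Finite R M] [Nontrivial M] :
    ∃ n s : ℕ, n + s = t ∧ localDepth R M = n ∧
      Nontrivial (Ext (ModuleCat.of R M) (ModuleCat.of R N) s) ∧
      ∀ i, s < i → Subsingleton (Ext (ModuleCat.of R M) (ModuleCat.of R N) i) := by
  generalize hI : Module.annihilator R M = I
  induction I using WellFoundedGT.induction generalizing M with
  | _ I ih =>
  subst hI
  by_cases h0 : localDepth R M = 0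
  · obtain ⟨f, hf⟩ := exists_mono_of_localDepth_eq_zero h0
    exact ⟨0, t, zero_add t, h0, nontrivial_ext_of_mono f _,
      fun i hi => HasInjectiveDimensionLT.subsingleton _ (t + 1) i hi _⟩
  -- Positive depth means Hom(k, M) = 0, which for finitely generated `M` yields an `M`-regular
  -- element of `𝔪`.
  · have h1 := le_localDepth_iff (n := 1).1
      (by rw [Nat.cast_one]; exact Order.one_le_iff_pos.2 (pos_iff_ne_zero.2 h0)) 0 one_pos
    have hsub : Subsingleton (Shrink.{w} (R ⧸ maximalIdeal R) →ₗ[R] M) :=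
      (Ext.addEquiv₀.toEquiv.trans ModuleCat.homEquiv).subsingleton_congr.1 h1
    have : Module.Finite R (Shrink.{w} (R ⧸ maximalIdeal R)) :=
      Module.Finite.equiv (Shrink.linearEquiv R _).symm
    obtain ⟨x, hx, hreg⟩ := IsSMulRegular.subsingleton_linearMap_iff.1 hsub
    rw [(Shrink.linearEquiv R (R ⧸ maximalIdeal R)).annihilator_eq,
      Ideal.annihilator_quotient] at hx
    have := nontrivial_quotSMulTop_of_mem_maximalIdeal M hx
    have hlt : Module.annihilator R M < Module.annihilator R (QuotSMulTop x M) := by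
      refine lt_of_le_of_ne
        (LinearMap.annihilator_le_of_surjective _ (Submodule.mkQ_surjective (x • ⊤))) fun h => ?_
      have hxM : x ∈ Module.annihilator R M := by
        rw [h]
        exact QuotSMulTop.mem_annihilator M x
      obtain ⟨m, hm⟩ := exists_ne (0 : M)
      refine hm (hreg ?_)
      simpa using Module.mem_annihilator.1 hxM m
    obtain ⟨n, s, hns, hn, hs, hvan⟩ := ih _ hlt (QuotSMulTop x M) rfl
    -- Ext^{i+1}(M/xM, N) = 0 for `i ≥ s`, so Nakayama kills Ext^i(M, N) already from degree `s` on.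
    have hM (i : ℕ) (hi : s ≤ i) :
        Subsingleton (Ext (ModuleCat.of R M) (ModuleCat.of R N) i) :=
      subsingleton_ext_of_forall_exists_smul S N (ModuleCat.of R M) hx i
        (forall_exists_smul_of_subsingleton_ext_quotSMulTop _ _ hreg (hvan _ (by lia)))
    have hT : (ModuleCat.smulShortComplex (ModuleCat.of R M) x).ShortExact :=
      IsSMulRegular.smulShortComplex_shortExact hreg
    cases s with
    -- `s = 0` is impossible: Hom(M/xM, N) embeds in Hom(M, N), which is zero.
    | zero =>
      refine absurd ?_ (not_subsingleton_iff_nontrivial.2 hs)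
      have := hT.epi_g
      have : Subsingleton (Ext (ModuleCat.smulShortComplex (ModuleCat.of R M) x).X₂
        (ModuleCat.of R N) 0) := hM 0 le_rfl
      exact (Ext.precomp_mk₀_injective_of_epi (ModuleCat.of R N)
        (ModuleCat.smulShortComplex (ModuleCat.of R M) x).g).subsingleton
    | succ s =>
      refine ⟨n + 1, s, by lia, localDepth_eq_succ_of_isSMulRegular hx hreg hn, ?_,
        fun i hi => hM i hi⟩
      -- Since Ext^{s+1}(M, N) = 0, the connecting map from Ext^s(M, N) onto Ext^{s+1}(M/xM, N) ≠ 0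
      -- is surjective.
      refine not_subsingleton_iff_nontrivial.1 fun hsub =>
        not_subsingleton_iff_nontrivial.2 hs (subsingleton_of_forall_eq 0 fun e => ?_)
      obtain ⟨l, rfl⟩ := Ext.contravariant_sequence_exact₃ hT _ e
        ((hM (s + 1) le_rfl).elim _ _) (add_comm 1 s)
      rw [show l = 0 from hsub.elim l 0, Ext.comp_zero]
      rfl

/-- Let `R → S` be a local homomorphism of noetherian local rings, `M` an `S`-module, and `N ≠ 0` a
finitely generated `S`-module of finite injective dimension over `R`. If `depth_R M = 0` or `M` is
finitely generated over `R`, then `depth R - depth_R M = sup {i | Ext^i_R(M, N) ≠ 0}`. -/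
theorem proposition3p5
    (R : Type u) [CommRing R] [IsLocalRing R] [IsNoetherianRing R] [Small.{w} R]
    (S : Type v) [CommRing S] [IsLocalRing S] [IsNoetherianRing S]
    [Algebra R S] [IsLocalHom (algebraMap R S)]
    (M : Type w) [AddCommGroup M] [Module R M] [Module S M] [IsScalarTower R S M]
    (N : Type w) [AddCommGroup N] [Module R N] [Module S N] [IsScalarTower R S N]
    [Nontrivial N] [Module.Finite S N]
    (hN : injectiveDimension (ModuleCat.of R N) ≠ ⊤)
    (hM : localDepth R M = 0 ∨ Module.Finite R M) :
    ((localDepth R R : ℕ∞) : EReal) - ((localDepth R M : ℕ∞) : EReal) = extSup R M N := by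
  obtain ⟨t, _, _⟩ := exists_hasInjectiveDimensionLT_and_nontrivial_ext_residueField S N hN
  -- Bass' formula: for `M = R`, projectivity forces the supremum to be 0, leaving depth `R` equal
  -- to `t`.
  have hR : localDepth R R = t := by
    have : Module.Finite R (Shrink.{w} R) := Module.Finite.equiv (Shrink.linearEquiv R R).symm
    obtain ⟨n, s, rfl, hn, hs, -⟩ := exists_localDepth_add_eq (R := R) S N (t := t) (Shrink.{w} R)
    rw [← localDepth_eq_of_linearEquiv (R := R) (Shrink.linearEquiv.{w} R R), hn]
    cases s with
    | zero => rfl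
    | succ s =>
      have : Projective (ModuleCat.of R (Shrink.{w} R)) := by
        have : Module.Free R (Shrink.{w} R) := .of_equiv (Shrink.linearEquiv R R).symm
        exact ModuleCat.projective_of_free (Module.Free.chooseBasis R (Shrink.{w} R))
      exact absurd (Ext.subsingleton_of_projective _ _ _) (not_subsingleton_iff_nontrivial.2 hs)
  by_cases h0 : localDepth R M = 0
  · obtain ⟨f, hf⟩ := exists_mono_of_localDepth_eq_zero h0
    rw [hR, h0, extSup_eq_coe (nontrivial_ext_of_mono f (ModuleCat.of R N) (t := t))
      fun i hi => HasInjectiveDimensionLT.subsingleton _ (t + 1) i hi _]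
    simp
    rfl
  have := hM.resolve_left h0
  obtain hsub | hnt := subsingleton_or_nontrivial M
  -- For `M = 0` the depth is `⊤`, and `t - ⊤ = ⊥` in `EReal` because `t` is finite.
  · have hzero : Limits.IsZero (ModuleCat.of R M) := ModuleCat.isZero_of_subsingleton _
    have htop : localDepth R M = ⊤ := by
      refine ENat.eq_top_iff_forall_ge.2 fun n => le_localDepth_iff.2 fun i _ => ?_
      refine subsingleton_of_forall_eq 0 fun e => ?_
      rw [← Ext.comp_mk₀_id e, hzero.eq_of_src (𝟙 _) 0, Ext.mk₀_zero, Ext.comp_zero]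
    have hbot : extSup R M N = ⊥ := by
      refine iSup₂_eq_bot.2 fun i hi => absurd ?_ (not_subsingleton_iff_nontrivial.2 hi)
      refine subsingleton_of_forall_eq 0 fun e => ?_
      rw [← Ext.mk₀_id_comp e, hzero.eq_of_src (𝟙 _) 0, Ext.mk₀_zero, Ext.zero_comp]
    rw [htop, hbot]
    simp
  · obtain ⟨n, s, rfl, hn, hs, hvan⟩ := exists_localDepth_add_eq (R := R) S N (t := t) M
    rw [hR, hn, extSup_eq_coe hs hvan]
    push_cast
    rw [add_comm]
    exact EReal.add_sub_cancel_right
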